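/- Let $R$ be a commutative ring with unit and let $I$ be an ideal of $R$ that is idempotent ($I^2 = I$) and is generated by a finite sequence of elements of $R$. Then the following two conditions are equivalent. 1. $I$ is strongly idempotent: $\mathrm{Tor}_i^R(R/I, R/I) = 0$ for all $i \ge 1$. 2. $I$ is weakly proregular: $I$ is generated by some weakly proregular finite sequence. Here a finite sequence $\mathbf r = (r_1, \dots, r_n)$ in $R$ is called weakly proregular if for every $p < 0$ the inverse system of $R$-modules $\{H^p(K(R; \mathbf r^i))\}_{i \ge 1}$ is pro-zero. In this definition $\mathbf r^i = (r_1^i, \dots, r_n^i)$, and $K(R; \mathbf r^i)$ is the Koszul complex, with term $\bigwedge^q R^n$ in cohomological degree $-q$ and differential given by contraction with the linear form $R^n \to R$, $e_k \mapsto r_k^i$. For $j \ge i$ the transition map is induced by the morphism of complexes $K(R; \mathbf r^j) \to K(R; \mathbf r^i)$ that is $\bigwedge^q$ of the map $e_k \mapsto r_k^{\,j-i} e_k$ in cohomological degree $-q$. An inverse system $\{M_i\}_{i \ge 1}$ is called pro-zero if for every $i$ there is $j \ge i$ such that the transition map $M_j \to M_i$ is zero. -/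

import Mathlib

open CategoryTheory

universe u

namespace Koszul

variable {R : Type u} [CommRing R] {M N : Type u} [AddCommGroup M] [Module R M]
  [AddCommGroup N] [Module R N]

/-- Contraction with a linear form lowers the degree in the exterior algebra by one. -/
theorem contractLeft_mem (φ : Module.Dual R M) (p : ℕ) :
    ∀ x ∈ ⋀[R]^(p + 1) M,
      CliffordAlgebra.contractLeft (Q := (0 : QuadraticForm R M)) φ x ∈ ⋀[R]^p M := by
  induction p with
  | zero =>
    intro x hx
    simp only [zero_add, pow_one, pow_zero] at hx ⊢
    obtain ⟨m, rfl⟩ := hx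
    refine Submodule.mem_one.2 ⟨φ m, ?_⟩
    exact (CliffordAlgebra.contractLeft_ι (Q := (0 : QuadraticForm R M)) φ m).symm
  | succ p ih =>
    intro x hx
    rw [ExteriorAlgebra.exteriorPower, pow_succ'] at hx
    induction hx using Submodule.mul_induction_on' with
    | mem_mul_mem a ha b hb =>
      obtain ⟨m, rfl⟩ := ha
      have h := CliffordAlgebra.contractLeft_ι_mul (Q := (0 : QuadraticForm R M)) φ m b
      have h2 : ExteriorAlgebra.ι R m *
          CliffordAlgebra.contractLeft (Q := (0 : QuadraticForm R M)) φ b ∈ ⋀[R]^(p + 1) M := by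
        rw [ExteriorAlgebra.exteriorPower, pow_succ']
        exact Submodule.mul_mem_mul ⟨m, rfl⟩ (ih b hb)
      have h1 : φ m • b ∈ ⋀[R]^(p + 1) M := Submodule.smul_mem _ _ hb
      have h3 := Submodule.sub_mem _ h1 h2
      exact h ▸ h3
    | add a _ b _ ha hb =>
      rw [map_add]
      exact Submodule.add_mem _ ha hb

/-- The Koszul differential `⋀^(p+1) M → ⋀^p M` of a linear form `φ : M → R`: contraction
with `φ`, i.e.
`m₀ ∧ ⋯ ∧ m_p ↦ ∑ k, (-1)^k φ(m_k) • m₀ ∧ ⋯ ∧ (m_k omitted) ∧ ⋯ ∧ m_p`. -/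
noncomputable def differential (φ : Module.Dual R M) (p : ℕ) : ⋀[R]^(p + 1) M →ₗ[R] ⋀[R]^p M :=
  LinearMap.restrict (CliffordAlgebra.contractLeft (Q := (0 : QuadraticForm R M)) φ)
    (contractLeft_mem φ p)

theorem differential_comp (φ : Module.Dual R M) (p : ℕ) :
    differential φ p ∘ₗ differential φ (p + 1) = 0 := by
  ext1
  ext x
  exact CliffordAlgebra.contractLeft_contractLeft (Q := (0 : QuadraticForm R M)) φ _

/-- The Koszul complex of a linear form `φ : M → R`, with `⋀^p M` in homological degree `p`,
that is, in cohomological degree `-p`. -/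
noncomputable abbrev complex (φ : Module.Dual R M) : ChainComplex (ModuleCat.{u} R) ℕ :=
  ChainComplex.of (fun p => ModuleCat.of R (⋀[R]^p M))
    (fun p => ModuleCat.ofHom (differential φ p))
    (fun p => by
      rw [← ModuleCat.ofHom_comp, differential_comp]
      rfl)

theorem complex_d (φ : Module.Dual R M) (p : ℕ) :
    (complex φ).d (p + 1) p = ModuleCat.ofHom (differential φ p) :=
  ChainComplex.of_d (fun p => ModuleCat.of R (⋀[R]^p M))
    (fun p => ModuleCat.ofHom (differential φ p)) p

theorem contractLeft_map (φ : Module.Dual R M) (ψ : Module.Dual R N) (f : M →ₗ[R] N)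
    (h : ψ ∘ₗ f = φ) (x : ExteriorAlgebra R M) :
    CliffordAlgebra.contractLeft (Q := (0 : QuadraticForm R N)) ψ (ExteriorAlgebra.map f x) =
      ExteriorAlgebra.map f
        (CliffordAlgebra.contractLeft (Q := (0 : QuadraticForm R M)) φ x) := by
  induction x using CliffordAlgebra.left_induction with
  | algebraMap r =>
    have h1 : ExteriorAlgebra.map f (algebraMap R (ExteriorAlgebra R M) r) =
        algebraMap R (ExteriorAlgebra R N) r := AlgHom.commutes _ r
    have h2 := CliffordAlgebra.contractLeft_algebraMap (Q := (0 : QuadraticForm R N)) ψ r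
    have h3 := CliffordAlgebra.contractLeft_algebraMap (Q := (0 : QuadraticForm R M)) φ r
    erw [h1, h2, h3, map_zero]
  | add x y hx hy => simp only [map_add, hx, hy]
  | ι_mul x m hx =>
    have h1 : ExteriorAlgebra.map f (ExteriorAlgebra.ι R m * x) =
        ExteriorAlgebra.ι R (f m) * ExteriorAlgebra.map f x := by
      rw [map_mul, ExteriorAlgebra.map_apply_ι]
    have h2 := CliffordAlgebra.contractLeft_ι_mul (Q := (0 : QuadraticForm R N)) ψ (f m)
      (ExteriorAlgebra.map f x)
    have h3 := CliffordAlgebra.contractLeft_ι_mul (Q := (0 : QuadraticForm R M)) φ m x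
    have h4 : ψ (f m) = φ m := LinearMap.congr_fun h m
    rw [hx, h4] at h2
    have h5 : ExteriorAlgebra.map f (φ m • x - ExteriorAlgebra.ι R m *
        CliffordAlgebra.contractLeft (Q := (0 : QuadraticForm R M)) φ x) =
        φ m • ExteriorAlgebra.map f x - ExteriorAlgebra.ι R (f m) * ExteriorAlgebra.map f
          (CliffordAlgebra.contractLeft (Q := (0 : QuadraticForm R M)) φ x) := by
      rw [map_sub, map_smul, map_mul, ExteriorAlgebra.map_apply_ι]
    exact (congrArg _ h1).trans (h2.trans (h5.symm.trans (congrArg _ h3.symm)))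

theorem coe_map (f : M →ₗ[R] N) (p : ℕ) (x : ⋀[R]^p M) :
    (exteriorPower.map p f x : ExteriorAlgebra R N) = ExteriorAlgebra.map f x := by
  have h : (⋀[R]^p N).subtype ∘ₗ exteriorPower.map p f =
      (ExteriorAlgebra.map f).toLinearMap ∘ₗ (⋀[R]^p M).subtype := by
    apply exteriorPower.linearMap_ext
    ext m
    simp
  exact LinearMap.congr_fun h x

theorem differential_map (φ : Module.Dual R M) (ψ : Module.Dual R N) (f : M →ₗ[R] N)
    (h : ψ ∘ₗ f = φ) (p : ℕ) :
    differential ψ p ∘ₗ exteriorPower.map (p + 1) f =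
      exteriorPower.map p f ∘ₗ differential φ p := by
  refine LinearMap.ext fun x => Subtype.ext ?_
  have h1 := contractLeft_map φ ψ f h x
  rw [← coe_map] at h1
  exact h1.trans (coe_map f p (differential φ p x)).symm

/-- The chain map of Koszul complexes induced by a linear map compatible with the linear forms:
it is `⋀^p f` in degree `p`. -/
noncomputable def complexMap (φ : Module.Dual R M) (ψ : Module.Dual R N) (f : M →ₗ[R] N)
    (h : ψ ∘ₗ f = φ) : complex φ ⟶ complex ψ :=
  ChainComplex.ofHom (fun p => ModuleCat.ofHom (exteriorPower.map p f))
    (fun p => by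
      rw [complex_d, complex_d]
      exact congrArg ModuleCat.ofHom (differential_map φ ψ f h p))

/-- The linear form `R^n → R` sending the `k`-th basis vector to `r k`. -/
noncomputable def form {n : ℕ} (r : Fin n → R) : Module.Dual R (Fin n → R) :=
  Fintype.linearCombination R r

/-- The endomorphism of `R^n` sending the `k`-th basis vector `e k` to `a k • e k`. -/
def diagonal {n : ℕ} (a : Fin n → R) : (Fin n → R) →ₗ[R] (Fin n → R) :=
  LinearMap.mulLeft R a

theorem form_comp_diagonal {n : ℕ} (r a : Fin n → R) :
    form r ∘ₗ diagonal a = form (a * r) := by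
  ext k
  simp [form, diagonal, Fintype.linearCombination_apply, Pi.single_apply]

/-- The Koszul complex `K(R; r)` of a finite sequence `r = (r₁, …, rₙ)` in `R`. Its homology in
degree `p` is the cohomology `H^(-p)(K(R; r))` in the cohomological indexing. -/
noncomputable abbrev complexOfSeq {n : ℕ} (r : Fin n → R) : ChainComplex (ModuleCat.{u} R) ℕ :=
  complex (form r)

/-- The inverse system of Koszul complexes `K(R; r^i)`, `i ≥ 1`, where `r^i = (r₁^i, …, rₙ^i)`.
For `j ≥ i` the transition map `K(R; r^j) ⟶ K(R; r^i)` is the identity in degree `0` and sends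
the basis vector `e k` to `(r k)^(j - i) • e k` in degree `1`; in degree `p` it is the `p`-th
exterior power of the map in degree `1`. -/
noncomputable def system {n : ℕ} (r : Fin n → R) : ℕ+ᵒᵖ ⥤ ChainComplex (ModuleCat.{u} R) ℕ where
  obj i := complexOfSeq (r ^ (i.unop : ℕ))
  map {j i} g := complexMap _ _ (diagonal (r ^ ((j.unop : ℕ) - (i.unop : ℕ)))) (by
    have hij : (i.unop : ℕ) ≤ (j.unop : ℕ) := leOfHom g.unop
    rw [form_comp_diagonal, ← pow_add, Nat.sub_add_cancel hij])
  map_id i := by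
    ext p : 1
    have h : diagonal (1 : Fin n → R) = LinearMap.id := LinearMap.ext fun x => one_mul x
    simp only [complexMap, Nat.sub_self, pow_zero, h, exteriorPower.map_id]
    rfl
  map_comp {k j i} g g' := by
    ext p : 1
    have hij : (i.unop : ℕ) ≤ (j.unop : ℕ) := leOfHom g'.unop
    have hjk : (j.unop : ℕ) ≤ (k.unop : ℕ) := leOfHom g.unop
    have h : diagonal (r ^ ((k.unop : ℕ) - (i.unop : ℕ))) =
        diagonal (r ^ ((j.unop : ℕ) - (i.unop : ℕ))) ∘ₗ
          diagonal (r ^ ((k.unop : ℕ) - (j.unop : ℕ))) := by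
      refine LinearMap.ext fun x => ?_
      have e : (k.unop : ℕ) - (i.unop : ℕ) =
        ((j.unop : ℕ) - (i.unop : ℕ)) + ((k.unop : ℕ) - (j.unop : ℕ)) := by omega
      simp only [diagonal, LinearMap.mulLeft_apply, LinearMap.comp_apply, e, pow_add, mul_assoc]
    simp only [complexMap, h, exteriorPower.map_comp, ModuleCat.ofHom_comp]
    rfl

end Koszul

/-- An inverse system `{M_i}_{i ≥ 1}` of modules is pro-zero if for every `i` there is some
`j ≥ i` such that the transition map `M_j ⟶ M_i` is zero. -/
def IsProZero {R : Type u} [CommRing R] (F : ℕ+ᵒᵖ ⥤ ModuleCat.{u} R) : Prop :=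
  ∀ i : ℕ+, ∃ (j : ℕ+) (h : i ≤ j), F.map (homOfLE h).op = 0

/-- A finite sequence `r` is weakly proregular if for every `p ≥ 1` the inverse system
`{H_p(K(R; r^i))}_{i ≥ 1}` is pro-zero (`H_p = H^(-p)`). -/
def IsWeaklyProregularSeq {R : Type u} [CommRing R] {n : ℕ} (r : Fin n → R) : Prop :=
  ∀ p : ℕ, 1 ≤ p → IsProZero
    (Koszul.system r ⋙ HomologicalComplex.homologyFunctor (ModuleCat.{u} R) _ p)

namespace Ideal

/-- An ideal is weakly proregular if it is generated by a weakly proregular finite sequence. -/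
def IsWeaklyProregular {R : Type u} [CommRing R] (I : Ideal R) : Prop :=
  ∃ (n : ℕ) (r : Fin n → R), Ideal.span (Set.range r) = I ∧ IsWeaklyProregularSeq r

/-- An ideal `I` is strongly idempotent if `Tor_i^R(R/I, R/I) = 0` for all `i ≥ 1`. -/
def IsStronglyIdempotent {R : Type u} [CommRing R] (I : Ideal R) : Prop :=
  ∀ i : ℕ, 1 ≤ i → Limits.IsZero
    (((Tor (ModuleCat.{u} R) i).obj (ModuleCat.of R (R ⧸ I))).obj (ModuleCat.of R (R ⧸ I)))

end Ideal

/-! A finitely generated idempotent ideal is generated by a single idempotent `e`, and for such an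
ideal both conditions hold outright; neither is deduced from the other. Since `R = Re ⊕ R(1 - e)`,
the module `R/(e)` is projective and its higher Tor vanishes. For weak proregularity one may choose
the generators, and the one-term sequence `e` works: its Koszul complex vanishes above degree 1,
where the cycles are the elements killed by `e`, and each transition map between distinct levels
multiplies them by `e`. -/

/-- The quotient of a commutative ring by an ideal generated by an idempotent is projective: the
projection is split by multiplication with the complementary idempotent. -/
theorem Ideal.projective_quotient_span_singleton {R : Type u} [CommRing R] {e : R}
    (he : IsIdempotentElem e) : Module.Projective R (R ⧸ Ideal.span {e}) := by
  have hker : Ideal.span {e} ≤ LinearMap.ker (LinearMap.mulLeft R (1 - e)) := by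
    rw [Ideal.span_singleton_le_iff_mem, LinearMap.mem_ker, LinearMap.mulLeft_apply,
      he.one_sub_mul_self]
  refine Module.Projective.of_split (Submodule.liftQ _ _ hker)
    (Submodule.mkQ (Ideal.span {e})) ?_
  refine Submodule.linearMap_qext _ (LinearMap.ext fun x => ?_)
  refine (Submodule.Quotient.eq _).2 (Ideal.mem_span_singleton'.2 ⟨-x, ?_⟩)
  change -x * e = (1 - e) * x - x
  ring

/-- An ideal generated by an idempotent is strongly idempotent. -/
theorem Ideal.isStronglyIdempotent_span_singleton {R : Type u} [CommRing R] {e : R}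
    (he : IsIdempotentElem e) : (Ideal.span {e}).IsStronglyIdempotent := by
  intro i hi
  obtain ⟨k, rfl⟩ := Nat.exists_eq_succ_of_ne_zero (Nat.one_le_iff_ne_zero.1 hi)
  have := Ideal.projective_quotient_span_singleton he
  have : Projective (ModuleCat.of R (R ⧸ Ideal.span {e})) :=
    (IsProjective.iff_projective _).1 this
  exact isZero_Tor_succ_of_projective (ModuleCat.{u} R) _ _ k

namespace Koszul

/-- A linear map out of a free module of rank one induces zero on exterior powers of degree at
least two. -/
theorem exteriorPower_map_eq_zero {R : Type u} [CommRing R] {N : Type u} [AddCommGroup N]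
    [Module R N] (f : (Fin 1 → R) →ₗ[R] N) (p : ℕ) : exteriorPower.map (p + 2) f = 0 := by
  refine exteriorPower.linearMap_ext (AlternatingMap.ext fun v => ?_)
  -- In rank one every vector is a multiple of the basis vector `1`, so by multilinearity the wedge
  -- is a multiple of `1 ∧ ⋯ ∧ 1`, which has a repeated entry.
  have hv : v = fun k => v k 0 • (1 : Fin 1 → R) := by
    ext k l
    simp [Subsingleton.elim l 0]
  have h0 : exteriorPower.ιMulti R (p + 2) (fun _ : Fin (p + 2) => (1 : Fin 1 → R)) = 0 :=
    AlternatingMap.map_eq_zero_of_eq _ _ (i := 0) (j := 1) rfl (by simp)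
  have h1 : exteriorPower.ιMulti R (p + 2) v = 0 := by
    rw [hv]
    exact ((exteriorPower.ιMulti R (p + 2)).toMultilinearMap.map_smul_univ
      (fun k => v k 0) (fun _ => 1)).trans (by erw [h0]; exact smul_zero _)
  simp only [LinearMap.compAlternatingMap_apply, h1, map_zero]

/-- The endomorphism induced by multiplication with `e` annihilates the cycles of positive degree in
the Koszul complex of the one-term sequence `e`. -/
theorem exteriorPower_map_diagonal_eq_zero {R : Type u} [CommRing R] {e : R}
    (φ : Module.Dual R (Fin 1 → R)) (hφ : φ = form fun _ => e) {a : Fin 1 → R}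
    (ha : a = fun _ => e) (p : ℕ) (x : ⋀[R]^(p + 1) (Fin 1 → R)) (hx : differential φ p x = 0) :
    exteriorPower.map (p + 1) (diagonal a) x = 0 := by
  subst ha
  cases p with
  | succ q => rw [exteriorPower_map_eq_zero]; rfl
  | zero =>
    obtain ⟨x, hx'⟩ := x
    have hmem := hx'
    rw [ExteriorAlgebra.exteriorPower, zero_add, pow_one] at hmem
    obtain ⟨m, rfl⟩ := hmem
    refine Subtype.ext ((coe_map _ _ _).trans ?_)
    -- In degree 1 the differential of `m` is the scalar `φ m = m 0 * e`. Scalars embed in the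
    -- exterior algebra, so a cycle satisfies `e * m 0 = 0`.
    have h1 : algebraMap R (ExteriorAlgebra R (Fin 1 → R)) (φ m) = 0 :=
      (CliffordAlgebra.contractLeft_ι (Q := (0 : QuadraticForm R (Fin 1 → R))) φ m).symm.trans
        (congrArg Subtype.val hx)
    have h2 : φ m = 0 := (ExteriorAlgebra.algebraMap_eq_zero_iff _ _).1 h1
    have h3 : diagonal (fun _ : Fin 1 => e) m = 0 := by
      ext k
      rw [Subsingleton.elim k 0]
      simpa [hφ, form, diagonal, Fintype.linearCombination_apply, mul_comm] using h2
    exact (ExteriorAlgebra.map_apply_ι _ _).trans (by rw [h3, map_zero]; rfl)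

end Koszul

/-- A morphism of complexes which annihilates the cycles of some degree is zero on the homology
of that degree. -/
theorem HomologicalComplex.homologyMap_eq_zero_of_iCycles_comp {C ι : Type*} [Category* C]
    [Abelian C] {c : ComplexShape ι} {K L : HomologicalComplex C c} (f : K ⟶ L) (i : ι)
    (h : K.iCycles i ≫ f.f i = 0) : HomologicalComplex.homologyMap f i = 0 := by
  have h1 : HomologicalComplex.cyclesMap f i = 0 := by
    rw [← cancel_mono (L.iCycles i), HomologicalComplex.cyclesMap_i, h, Limits.zero_comp]
  rw [← cancel_epi (K.homologyπ i), HomologicalComplex.homologyπ_naturality, h1,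
    Limits.zero_comp, Limits.comp_zero]

/-- The one-term sequence consisting of an idempotent is weakly proregular. -/
theorem IsIdempotentElem.isWeaklyProregularSeq {R : Type u} [CommRing R] {e : R}
    (he : IsIdempotentElem e) : IsWeaklyProregularSeq (fun _ : Fin 1 => e) := by
  intro p hp i
  obtain ⟨q, rfl⟩ := Nat.exists_eq_succ_of_ne_zero (Nat.one_le_iff_ne_zero.1 hp)
  -- Any `j > i` would do: a positive exponent `j - i` is needed for a factor `e` to appear.
  refine ⟨i + 1, (PNat.lt_add_right i 1).le,
    HomologicalComplex.homologyMap_eq_zero_of_iCycles_comp _ _ ?_⟩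
  ext x
  have hpow : (fun _ : Fin 1 => e) ^ ((i + 1 : ℕ+) : ℕ) = fun _ => e :=
    funext fun _ => he.pow_eq (i + 1).ne_zero
  have hsub : (fun _ : Fin 1 => e) ^ (((i + 1 : ℕ+) : ℕ) - (i : ℕ)) = fun _ => e := by
    rw [PNat.add_coe, PNat.one_coe, Nat.add_sub_cancel_left, pow_one]
  have hd := ConcreteCategory.congr_hom
    ((Koszul.complexOfSeq ((fun _ : Fin 1 => e) ^ ((i + 1 : ℕ+) : ℕ))).iCycles_d (q + 1) q) x
  rw [Koszul.complex_d] at hd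
  exact Koszul.exteriorPower_map_diagonal_eq_zero _ (congrArg Koszul.form hpow) hsub q _ hd

/-- An ideal generated by an idempotent is weakly proregular. -/
theorem Ideal.isWeaklyProregular_span_singleton {R : Type u} [CommRing R] {e : R}
    (he : IsIdempotentElem e) : (Ideal.span {e}).IsWeaklyProregular :=
  ⟨1, fun _ => e, by rw [Set.range_const], he.isWeaklyProregularSeq⟩

theorem proposition4p3 {R : Type u} [CommRing R] (I : Ideal R) (hI : IsIdempotentElem I)
    {n : ℕ} (r : Fin n → R) (hr : Ideal.span (Set.range r) = I) :
    I.IsStronglyIdempotent ↔ I.IsWeaklyProregular := by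
  have hfg : I.FG := hr ▸ Submodule.fg_span (Set.finite_range r)
  -- By Nakayama, `I = I * I` with `I` finitely generated gives an element of `I` acting as the
  -- identity on `I`; it is an idempotent generator.
  obtain ⟨e, he, rfl⟩ := (Ideal.isIdempotentElem_iff_of_fg I hfg).1 hI
  exact iff_of_true (Ideal.isStronglyIdempotent_span_singleton he)
    (Ideal.isWeaklyProregular_span_singleton he)
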